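/- Let $M$ be a connected smooth manifold, let $(\mathcal A,[\cdot,\cdot]_{\mathcal A},\rho)$ be a transitive Lie algebroid over $M$ (a finite-rank real vector bundle $\mathcal A\to M$ with a fibrewise surjective anchor $\rho:\mathcal A\to TM$), and let $L=\ker\rho$. Let $F\to M$ be a finite-rank real vector bundle, and let $\mathfrak L$ be a representation of $\mathcal A$ on $F$, i.e. a Lie algebroid morphism from $\mathcal A$ to the Lie algebroid of covariant differential operators of $F$. Write $$F_0=\{\nu\in F_x \mid x\in M,\ \mathfrak L_u\nu=0 \text{ for all } u\in L_x\},$$ and let $\bar{\mathfrak L}$ be the reduced flat connection on $F_0$: $\bar{\mathfrak L}_X\nu=\mathfrak L_u\nu$ for $\nu\in\Gamma(F_0)$ and any $u\in\mathcal A_x$ with $\rho(u)=X\in T_xM$. An $F_0$-valued bundle map means a smooth bundle map into $F$ with values in $F_0$, and $\Gamma(F_0)$ is the space of smooth sections of $F$ with values in $F_0$. Let $D^1(\mathcal A,F)$ be the space of smooth bundle maps $\Omega:\mathcal A\to F$ with $\Omega([a,b]_{\mathcal A})=\mathfrak L_a(\Omega(b))-\mathfrak L_b(\Omega(a))$ for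 all $a,b\in\Gamma(\mathcal A)$, let $B^1(\mathcal A,F)$ be the space of maps $a\mapsto\mathfrak L_a\mu$ with $\mu\in\Gamma(F)$, and let $H^1(\mathcal A,F)=D^1(\mathcal A,F)/B^1(\mathcal A,F)$. Let $D^1(\mathcal A,F_0)_0$ be the space of $F_0$-valued $\Omega\in D^1(\mathcal A,F)$ with $\Omega|_L=0$. Let $D^1(TM,F_0)$ be the space of $F_0$-valued $1$-forms $\theta$ on $M$ that are closed, i.e. $\bar{\mathfrak L}_X(\theta(Y))-\bar{\mathfrak L}_Y(\theta(X))-\theta([X,Y])=0$ for all vector fields $X,Y$, and let $H^1_{deR}(M,F_0)=D^1(TM,F_0)/\{X\mapsto\bar{\mathfrak L}_X\nu \mid \nu\in\Gamma(F_0)\}$. Then the map $\theta\mapsto\rho^*\theta=\theta\circ\rho$ is a bijection from $D^1(TM,F_0)$ onto $D^1(\mathcal A,F_0)_0$. Moreover, it induces a well-defined injective linear map $H^1_{deR}(M,F_0)\to H^1(\mathcal A,F)$, $[\theta]\mapsto[\rho^*\theta]$. -/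

import Mathlib

open Bundle Set
open scoped Manifold ContDiff Topology

noncomputable section

namespace LieAlgd

/-! ### Smooth sections and smooth bundle maps -/

section Bundles

variable (E : Type*) [NormedAddCommGroup E] [NormedSpace ℝ E]
  {M : Type*} [TopologicalSpace M] [ChartedSpace E M]

/-- The space `Γ(V)` of smooth sections of a vector bundle `V → M` with model fibre `FV`. -/
abbrev Sec (FV : Type*) [NormedAddCommGroup FV] [NormedSpace ℝ FV]
    (V : M → Type*) [∀ x, TopologicalSpace (V x)] [TopologicalSpace (TotalSpace FV V)]
    [FiberBundle FV V] :=
  ContMDiffSection 𝓘(ℝ, E) FV ∞ V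

/-- The tangent bundle of `M`. -/
abbrev TB (M : Type*) [TopologicalSpace M] [ChartedSpace E M] (x : M) : Type _ :=
  TangentSpace 𝓘(ℝ, E) x

/-- The space `𝒳(M)` of smooth vector fields. -/
abbrev VF (M : Type*) [TopologicalSpace M] [ChartedSpace E M] [IsManifold 𝓘(ℝ, E) ∞ M] :=
  Sec E E (TB E M)

variable (FV : Type*) [NormedAddCommGroup FV] [NormedSpace ℝ FV]
  (V : M → Type*) [∀ x, AddCommGroup (V x)] [∀ x, Module ℝ (V x)] [∀ x, TopologicalSpace (V x)]
  [TopologicalSpace (TotalSpace FV V)] [FiberBundle FV V] [VectorBundle ℝ FV V]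
  (FW : Type*) [NormedAddCommGroup FW] [NormedSpace ℝ FW]
  (W : M → Type*) [∀ x, AddCommGroup (W x)] [∀ x, Module ℝ (W x)] [∀ x, TopologicalSpace (W x)]
  [TopologicalSpace (TotalSpace FW W)] [FiberBundle FW W] [VectorBundle ℝ FW W]
  [∀ x, IsTopologicalAddGroup (W x)] [∀ x, ContinuousSMul ℝ (W x)]

/-- Smooth vector bundle maps `V → W` over `M`, i.e. smooth sections of `Hom(V, W)`. -/
abbrev BundleMap :=
  ContMDiffSection 𝓘(ℝ, E) (FV →L[ℝ] FW) ∞ (fun x : M ↦ V x →L[ℝ] W x)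

variable {E FV V FW W}

/-- The product `f • s` of a smooth function and a smooth section. -/
def fsmul (f : C^∞⟮𝓘(ℝ, E), M; 𝓘(ℝ, ℝ), ℝ⟯) (s : Sec E FV V) : Sec E FV V :=
  ⟨fun x ↦ f x • s x, ContMDiff.smul_section f.contMDiff s.contMDiff⟩

/-- The section `Ω(s)` obtained by applying a smooth bundle map to a smooth section. -/
def BundleMap.app (Ω : BundleMap E FV V FW W) (s : Sec E FV V) : Sec E FW W :=
  ⟨fun x ↦ Ω x (s x), ContMDiff.clm_bundle_apply Ω.contMDiff s.contMDiff⟩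

variable {FU : Type*} [NormedAddCommGroup FU] [NormedSpace ℝ FU]
  {U : M → Type*} [∀ x, AddCommGroup (U x)] [∀ x, Module ℝ (U x)] [∀ x, TopologicalSpace (U x)]
  [TopologicalSpace (TotalSpace FU U)] [FiberBundle FU U] [VectorBundle ℝ FU U]
  [∀ x, IsTopologicalAddGroup (V x)] [∀ x, ContinuousSMul ℝ (V x)]

/-- The composition of smooth bundle maps is smooth. -/
theorem contMDiff_bundleMap_comp (θ : BundleMap E FV V FW W) (ρ : BundleMap E FU U FV V) :
    ContMDiff 𝓘(ℝ, E) (𝓘(ℝ, E).prod 𝓘(ℝ, FU →L[ℝ] FW)) ∞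
      (fun x ↦ TotalSpace.mk' (FU →L[ℝ] FW) (E := fun x : M ↦ U x →L[ℝ] W x) x
        ((θ x).comp (ρ x))) := by
  intro x₀
  have h1 := ((contMDiffAt_hom_bundle _).1 (θ.contMDiff x₀)).2
  have h2 := ((contMDiffAt_hom_bundle _).1 (ρ.contMDiff x₀)).2
  refine (contMDiffAt_hom_bundle _).2 ⟨contMDiffAt_id, ?_⟩
  refine (h1.clm_comp h2).congr_of_eventuallyEq ?_
  have hV : ∀ᶠ x in 𝓝 x₀, x ∈ (trivializationAt FV V x₀).baseSet :=
    (trivializationAt FV V x₀).open_baseSet.mem_nhds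
      (FiberBundle.mem_baseSet_trivializationAt' x₀)
  filter_upwards [hV] with x hx
  ext v
  simp [ContinuousLinearMap.inCoordinates, hx]

/-- Precomposition `ρ^* : θ ↦ θ ∘ ρ` with a bundle map `ρ : U → V`, as a linear map
`Γ(Hom(V, W)) → Γ(Hom(U, W))`. -/
def BundleMap.pullback (ρ : BundleMap E FU U FV V) :
    BundleMap E FV V FW W →ₗ[ℝ] BundleMap E FU U FW W where
  toFun θ := ⟨fun x ↦ (θ x).comp (ρ x), contMDiff_bundleMap_comp θ ρ⟩
  map_add' θ θ' := by ext x; rfl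
  map_smul' c θ := by ext x; rfl

end Bundles

/-! ### Lie algebroids, covariant differential operators and representations -/

section Algebroids

variable (E : Type*) [NormedAddCommGroup E] [NormedSpace ℝ E]
  {M : Type*} [TopologicalSpace M] [ChartedSpace E M] [IsManifold 𝓘(ℝ, E) ∞ M]
  (FA : Type*) [NormedAddCommGroup FA] [NormedSpace ℝ FA]
  (A : M → Type*) [∀ x, AddCommGroup (A x)] [∀ x, Module ℝ (A x)] [∀ x, TopologicalSpace (A x)]
  [TopologicalSpace (TotalSpace FA A)] [FiberBundle FA A] [VectorBundle ℝ FA A]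

/-- A Lie algebroid structure on the vector bundle `A → M`. -/
structure LieAlgebroid where
  /-- The anchor `ρ : A → TM`. -/
  anchor : BundleMap E FA A E (TB E M)
  /-- The bracket on `Γ(A)`. -/
  bracket : Sec E FA A →ₗ[ℝ] Sec E FA A →ₗ[ℝ] Sec E FA A
  bracket_self : ∀ a, bracket a a = 0
  jacobi : ∀ a b c,
    bracket a (bracket b c) = bracket (bracket a b) c + bracket b (bracket a c)
  anchor_bracket : ∀ (a b : Sec E FA A) (x : M), anchor x (bracket a b x) =
    VectorField.mlieBracket 𝓘(ℝ, E) (fun y ↦ anchor y (a y)) (fun y ↦ anchor y (b y)) x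
  leibniz : ∀ (f : C^∞⟮𝓘(ℝ, E), M; 𝓘(ℝ, ℝ), ℝ⟯) (a b : Sec E FA A) (x : M),
    bracket a (fsmul f b) x =
      f x • bracket a b x + (mvfderiv 𝓘(ℝ, E) f x (anchor x (a x))) • b x

variable (FF : Type*) [NormedAddCommGroup FF] [NormedSpace ℝ FF]
  (F : M → Type*) [∀ x, AddCommGroup (F x)] [∀ x, Module ℝ (F x)] [∀ x, TopologicalSpace (F x)]
  [TopologicalSpace (TotalSpace FF F)] [FiberBundle FF F] [VectorBundle ℝ FF F]

/-- The fibre `CDO(F)_x`: pairs of an `ℝ`-linear operator `D : Γ(F) → F_x` and its symbol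
`X ∈ T_xM`, with `D(f μ) = X(f) μ(x) + f(x) D μ`. (The symbol is determined by `D` unless `F`
has rank zero.) -/
def CDO (x : M) : Submodule ℝ ((Sec E FF F →ₗ[ℝ] F x) × TB E M x) where
  carrier := {D | ∀ (f : C^∞⟮𝓘(ℝ, E), M; 𝓘(ℝ, ℝ), ℝ⟯) (μ : Sec E FF F),
    D.1 (fsmul f μ) = (mvfderiv 𝓘(ℝ, E) f x D.2) • μ x + f x • D.1 μ}
  zero_mem' := by intro f μ; simp
  add_mem' := by
    intro D D' hD hD' f μ
    simp only [Prod.fst_add, Prod.snd_add, LinearMap.add_apply, hD f μ, hD' f μ, map_add]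
    module
  smul_mem' := by
    intro c D hD f μ
    simp only [Prod.smul_fst, Prod.smul_snd, LinearMap.smul_apply, hD f μ, map_smul, smul_eq_mul]
    module

variable {E FA A}

/-- A representation of a Lie algebroid on `F`: a bundle map `𝔏 : A → CDO(F)` that is a Lie
algebroid morphism. Smoothness of `𝔏` means that for every smooth section `a` of `A` the operator
`μ ↦ 𝔏_a μ` maps smooth sections of `F` to smooth sections of `F`. -/
structure LieAlgebroid.Representation (𝒜 : LieAlgebroid E FA A) where
  /-- The fibrewise linear map `A_x → CDO(F)_x`. -/
  toCDO : ∀ x, A x →ₗ[ℝ] CDO E FF F x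
  symbol_eq : ∀ x (u : A x), (toCDO x u).1.2 = 𝒜.anchor x u
  smooth : ∀ (a : Sec E FA A) (μ : Sec E FF F),
    ContMDiff 𝓘(ℝ, E) (𝓘(ℝ, E).prod 𝓘(ℝ, FF)) ∞
      (fun x ↦ TotalSpace.mk' FF x ((toCDO x (a x)).1.1 μ))
  map_bracket : ∀ (a b : Sec E FA A) (μ : Sec E FF F) (x : M),
    (toCDO x (𝒜.bracket a b x)).1.1 μ =
      (toCDO x (a x)).1.1 ⟨fun y ↦ (toCDO y (b y)).1.1 μ, smooth b μ⟩ -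
        (toCDO x (b x)).1.1 ⟨fun y ↦ (toCDO y (a y)).1.1 μ, smooth a μ⟩

/-- The Lie algebroid is transitive: the anchor is (fibrewise) surjective. -/
def LieAlgebroid.Transitive (𝒜 : LieAlgebroid E FA A) : Prop :=
  ∀ x, Function.Surjective (𝒜.anchor x)

/-- The fibre `L_x = ker ρ_x` of the adjoint bundle. -/
def LieAlgebroid.L (𝒜 : LieAlgebroid E FA A) (x : M) : Submodule ℝ (A x) :=
  LinearMap.ker (𝒜.anchor x : A x →ₗ[ℝ] TB E M x)

namespace LieAlgebroid.Representation

variable {FF F} {𝒜 : LieAlgebroid E FA A} (R : 𝒜.Representation FF F)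

/-- `𝔏_u μ ∈ F_x` for `u ∈ A_x` and `μ ∈ Γ(F)`. -/
def op {x : M} (u : A x) : Sec E FF F →ₗ[ℝ] F x := (R.toCDO x u).1.1

theorem op_fsmul {x : M} (u : A x) (f : C^∞⟮𝓘(ℝ, E), M; 𝓘(ℝ, ℝ), ℝ⟯) (μ : Sec E FF F) :
    R.op u (fsmul f μ) = (mvfderiv 𝓘(ℝ, E) f x (𝒜.anchor x u)) • μ x + f x • R.op u μ := by
  rw [← R.symbol_eq]
  exact (R.toCDO x u).2 f μ

theorem op_add {x : M} (u v : A x) (μ : Sec E FF F) : R.op (u + v) μ = R.op u μ + R.op v μ := by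
  simp [op]

theorem op_sub {x : M} (u v : A x) (μ : Sec E FF F) : R.op (u - v) μ = R.op u μ - R.op v μ := by
  simp [op]

/-- The fibre `F_{0x} = {ν ∈ F_x | 𝔏_u ν = 0 for all u ∈ L_x}`, where `𝔏_u ν = 𝔏_u μ` for a
smooth section `μ` of `F` that extends `ν` (by `op_eq_of_mem_L` below, `𝔏_u μ` does not depend on
the extension). -/
def F₀ (x : M) : Submodule ℝ (F x) where
  carrier := {ν | ∀ u ∈ 𝒜.L x, ∃ μ : Sec E FF F, μ x = ν ∧ R.op u μ = 0}
  zero_mem' := fun u _ ↦ ⟨0, rfl, map_zero _⟩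
  add_mem' := by
    intro ν ν' h h' u hu
    obtain ⟨μ, rfl, h1⟩ := h u hu
    obtain ⟨μ', rfl, h2⟩ := h' u hu
    exact ⟨μ + μ', rfl, by rw [map_add, h1, h2, add_zero]⟩
  smul_mem' := by
    intro c ν h u hu
    obtain ⟨μ, rfl, h1⟩ := h u hu
    exact ⟨c • μ, rfl, by rw [map_smul, h1, smul_zero]⟩

/-- Sections of the subbundle `F₀`: sections of `F` with values in `F₀`. -/
def secF₀ : Submodule ℝ (Sec E FF F) where
  carrier := {ν | ∀ x, ν x ∈ R.F₀ x}
  zero_mem' := fun x ↦ (R.F₀ x).zero_mem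
  add_mem' := fun h h' x ↦ (R.F₀ x).add_mem (h x) (h' x)
  smul_mem' := fun c _ h x ↦ (R.F₀ x).smul_mem c (h x)

section WellDefined

variable [FiniteDimensional ℝ E] [T2Space M] [FiniteDimensional ℝ FF]
  [ContMDiffVectorBundle ∞ FF F 𝓘(ℝ, E)]

/-- For `u ∈ L_x`, the value `𝔏_u μ` depends only on `μ(x)`. -/
theorem op_eq_of_mem_L {x : M} {u : A x} (hu : u ∈ 𝒜.L x) {μ μ' : Sec E FF F}
    (h : μ x = μ' x) : R.op u μ = R.op u μ' := by
  have hu0 : 𝒜.anchor x u = 0 := hu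
  have hop : ∀ (f : C^∞⟮𝓘(ℝ, E), M; 𝓘(ℝ, ℝ), ℝ⟯) (ν : Sec E FF F),
      R.op u (fsmul f ν) = f x • R.op u ν := by
    intro f ν
    rw [op_fsmul, hu0, map_zero, zero_smul, zero_add]
  suffices H : ∀ ν : Sec E FF F, ν x = 0 → R.op u ν = 0 by
    have h0 := H (μ - μ') (by
      change μ x - μ' x = 0
      rw [h, sub_self])
    rw [map_sub] at h0
    exact sub_eq_zero.1 h0
  intro ν hν
  have : ContMDiffVectorBundle 1 FF F 𝓘(ℝ, E) := ContMDiffVectorBundle.of_le (n := ∞) (by simp)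
  let t := trivializationAt FF F x
  have hx : x ∈ t.baseSet := FiberBundle.mem_baseSet_trivializationAt' x
  let b := Module.finBasis ℝ FF
  obtain ⟨χ, -, hχ⟩ := (SmoothBumpFunction.nhds_basis_tsupport (I := 𝓘(ℝ, E)) x).mem_iff.1
    (t.open_baseSet.mem_nhds hx)
  let χ' : C^∞⟮𝓘(ℝ, E), M; 𝓘(ℝ, ℝ), ℝ⟯ := ⟨χ, χ.contMDiff⟩
  let s : Fin (Module.finrank ℝ FF) → Sec E FF F := fun i ↦
    ⟨fun y ↦ χ y • t.localFrame b i y,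
      ContMDiffOn.smul_section_of_tsupport (χ.contMDiff.contMDiffOn) t.open_baseSet hχ
        (t.contMDiffOn_localFrame_baseSet ∞ b i)⟩
  let c : Fin (Module.finrank ℝ FF) → C^∞⟮𝓘(ℝ, E), M; 𝓘(ℝ, ℝ), ℝ⟯ := fun i ↦
    ⟨fun y ↦ χ y • t.localFrameCoeff 𝓘(ℝ, E) b i y (ν y), by
      refine contMDiff_of_tsupport fun y hy ↦ ?_
      have hy' : y ∈ t.baseSet := hχ (tsupport_smul_subset_left _ _ hy)
      exact χ.contMDiffAt.smul (contMDiffAt_localFrameCoeff b hy' (ν.contMDiff y) i)⟩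
  have key : fsmul χ' (fsmul χ' ν) = ∑ i, fsmul (c i) (s i) := by
    ext y
    have hsum : (∑ i, fsmul (c i) (s i) : Sec E FF F) y = ∑ i, (fsmul (c i) (s i)) y := by
      change ContMDiffSection.coeAddHom 𝓘(ℝ, E) FF ∞ F (∑ i, fsmul (c i) (s i)) y = _
      rw [map_sum, Finset.sum_apply]
      rfl
    rw [hsum]
    change χ y • χ y • ν y = ∑ i, (χ y • t.localFrameCoeff 𝓘(ℝ, E) b i y (ν y)) •
      (χ y • t.localFrame b i y)
    by_cases hy : y ∈ t.baseSet
    · conv_lhs => rw [t.eq_sum_localFrameCoeff_smul (I := 𝓘(ℝ, E)) (b := b) (s := ν) hy]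
      rw [Finset.smul_sum, Finset.smul_sum]
      refine Finset.sum_congr rfl fun i _ ↦ ?_
      simp only [smul_smul, smul_eq_mul]
      congr 1
      ring
    · have hχ0 : χ y = 0 := image_eq_zero_of_notMem_tsupport fun h' ↦ hy (hχ h')
      simp [hχ0]
  have h1 : R.op u (fsmul χ' (fsmul χ' ν)) = R.op u ν := by
    have : χ' x = 1 := χ.eq_one
    rw [hop, hop, this, one_smul, one_smul]
  rw [← h1, key, map_sum]
  refine Finset.sum_eq_zero fun i _ ↦ ?_
  have hc : c i x = 0 := by
    change χ x • t.localFrameCoeff 𝓘(ℝ, E) b i x (ν x) = 0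
    rw [hν, map_zero, smul_zero]
  rw [hop, hc, zero_smul]

/-- For `ν ∈ Γ(F₀)`, the value `𝔏_u ν` depends only on `ρ(u)`. -/
theorem op_eq_of_anchor_eq {x : M} {u v : A x} (huv : 𝒜.anchor x u = 𝒜.anchor x v)
    {ν : Sec E FF F} (hν : ν ∈ R.secF₀) : R.op u ν = R.op v ν := by
  have hmem : u - v ∈ 𝒜.L x := by
    simp [LieAlgebroid.L, huv]
  obtain ⟨μ, h1, h2⟩ := hν x (u - v) hmem
  have h3 := R.op_eq_of_mem_L hmem h1
  rw [h2, op_sub] at h3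
  exact (sub_eq_zero.1 h3.symm)

end WellDefined

/-! #### Cohomology of `A` in degree one -/

section Cohomology

variable [∀ x, IsTopologicalAddGroup (F x)] [∀ x, ContinuousSMul ℝ (F x)]

/-- `D¹(A, F)`: the `1`-cocycles, i.e. the bundle maps `Ω : A → F` with
`Ω[a, b] = 𝔏_a(Ω(b)) - 𝔏_b(Ω(a))` for all `a, b ∈ Γ(A)`. -/
def cocycles : Submodule ℝ (BundleMap E FA A FF F) where
  carrier := {Ω | ∀ (a b : Sec E FA A) (x : M),
    Ω x (𝒜.bracket a b x) = R.op (a x) (Ω.app b) - R.op (b x) (Ω.app a)}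
  zero_mem' := by
    intro a b x
    have h : ∀ c : Sec E FA A, BundleMap.app (0 : BundleMap E FA A FF F) c = 0 := fun c ↦ rfl
    simp [h]
  add_mem' := by
    intro Ω Ω' hΩ hΩ' a b x
    have h : ∀ c : Sec E FA A, BundleMap.app (Ω + Ω') c = Ω.app c + Ω'.app c := fun c ↦ rfl
    have h1 := hΩ a b x
    have h2 := hΩ' a b x
    rw [h, h, map_add, map_add]
    change Ω x _ + Ω' x _ = _
    rw [h1, h2]
    abel
  smul_mem' := by
    intro c Ω hΩ a b x
    have h : ∀ s : Sec E FA A, BundleMap.app (c • Ω) s = c • Ω.app s := fun s ↦ rfl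
    have h1 := hΩ a b x
    rw [h, h, map_smul, map_smul]
    change c • Ω x _ = _
    rw [h1, smul_sub]

/-- `B¹(A, F)`: the coboundaries, i.e. the bundle maps of the form `a ↦ 𝔏_a μ` with
`μ ∈ Γ(F)`. -/
def coboundaries : Submodule ℝ (BundleMap E FA A FF F) where
  carrier := {Ω | ∃ μ : Sec E FF F, ∀ (x : M) (u : A x), Ω x u = R.op u μ}
  zero_mem' := ⟨0, fun x u ↦ (map_zero (R.op u)).symm⟩
  add_mem' := by
    rintro Ω Ω' ⟨μ, h⟩ ⟨μ', h'⟩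
    exact ⟨μ + μ', fun x u ↦ by rw [map_add, ← h, ← h']; rfl⟩
  smul_mem' := by
    rintro c Ω ⟨μ, h⟩
    exact ⟨c • μ, fun x u ↦ by rw [map_smul, ← h]; rfl⟩

theorem coboundaries_le_cocycles : R.coboundaries ≤ R.cocycles := by
  rintro Ω ⟨μ, h⟩ a b x
  have happ : ∀ c : Sec E FA A,
      Ω.app c = ⟨fun y ↦ (R.toCDO y (c y)).1.1 μ, R.smooth c μ⟩ := by
    intro c
    ext y
    exact h y (c y)
  rw [happ, happ, h]
  exact R.map_bracket a b μ x

/-- `H¹(A, F) = D¹(A, F) / B¹(A, F)`. -/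
abbrev H1 := R.cocycles ⧸ R.coboundaries.submoduleOf R.cocycles

/-- `D¹(A, F₀)₀`: the `F₀`-valued `1`-cocycles of `A` that vanish on `L`. -/
def cocyclesF₀Zero : Submodule ℝ (BundleMap E FA A FF F) where
  carrier := {Ω | Ω ∈ R.cocycles ∧ (∀ (x : M) (u : A x), Ω x u ∈ R.F₀ x) ∧
    ∀ (x : M), ∀ v ∈ 𝒜.L x, Ω x v = 0}
  zero_mem' := ⟨R.cocycles.zero_mem, fun x _ ↦ (R.F₀ x).zero_mem, fun _ _ _ ↦ rfl⟩
  add_mem' := by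
    rintro Ω Ω' ⟨h1, h2, h3⟩ ⟨h1', h2', h3'⟩
    refine ⟨R.cocycles.add_mem h1 h1', fun x u ↦ (R.F₀ x).add_mem (h2 x u) (h2' x u),
      fun x v hv ↦ ?_⟩
    change Ω x v + Ω' x v = 0
    rw [h3 x v hv, h3' x v hv, add_zero]
  smul_mem' := by
    rintro c Ω ⟨h1, h2, h3⟩
    refine ⟨R.cocycles.smul_mem c h1, fun x u ↦ (R.F₀ x).smul_mem c (h2 x u), fun x v hv ↦ ?_⟩
    change c • Ω x v = 0
    rw [h3 x v hv, smul_zero]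

/-! #### The reduced flat connection on `F₀` and de Rham cohomology of `M` in degree one -/

/-- The reduced connection `\bar 𝔏_X ν = 𝔏_u ν`, where `u ∈ A_x` is any element with `ρ(u) = X`.
It is used for `ν ∈ Γ(F₀)` only, where it does not depend on `u`, see `op_eq_of_anchor_eq`. -/
def reduced (h𝒜 : 𝒜.Transitive) {x : M} (X : TB E M x) : Sec E FF F →ₗ[ℝ] F x :=
  R.op (Function.surjInv (h𝒜 x) X)

/-- `D¹(TM, F₀)`: the closed `F₀`-valued `1`-forms on `M`, i.e. the bundle maps `θ : TM → F₀` with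
`\bar 𝔏_X(θ(Y)) - \bar 𝔏_Y(θ(X)) - θ([X, Y]) = 0` for all vector fields `X, Y`. -/
def closedForms (h𝒜 : 𝒜.Transitive) : Submodule ℝ (BundleMap E E (TB E M) FF F) where
  carrier := {θ | (∀ (x : M) (X : TB E M x), θ x X ∈ R.F₀ x) ∧
    ∀ (X Y : VF E M) (x : M),
      R.reduced h𝒜 (X x) (θ.app Y) - R.reduced h𝒜 (Y x) (θ.app X) -
        θ x (VectorField.mlieBracket 𝓘(ℝ, E) X Y x) = 0}
  zero_mem' := by
    refine ⟨fun x _ ↦ (R.F₀ x).zero_mem, fun X Y x ↦ ?_⟩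
    have h : ∀ Z : VF E M, BundleMap.app (0 : BundleMap E E (TB E M) FF F) Z = 0 := fun Z ↦ rfl
    simp [h]
  add_mem' := by
    rintro θ θ' ⟨h1, h2⟩ ⟨h1', h2'⟩
    refine ⟨fun x X ↦ (R.F₀ x).add_mem (h1 x X) (h1' x X), fun X Y x ↦ ?_⟩
    have h : ∀ Z : VF E M, BundleMap.app (θ + θ') Z = θ.app Z + θ'.app Z := fun Z ↦ rfl
    have e1 := h2 X Y x
    have e2 := h2' X Y x
    rw [h, h, map_add, map_add]
    change _ - (θ x _ + θ' x _) = 0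
    rw [← add_zero (0 : F x)]
    nth_rewrite 1 [← e1]
    rw [← e2]
    abel
  smul_mem' := by
    rintro c θ ⟨h1, h2⟩
    refine ⟨fun x X ↦ (R.F₀ x).smul_mem c (h1 x X), fun X Y x ↦ ?_⟩
    have h : ∀ Z : VF E M, BundleMap.app (c • θ) Z = c • θ.app Z := fun Z ↦ rfl
    have e1 := h2 X Y x
    rw [h, h, map_smul, map_smul]
    change _ - c • θ x _ = 0
    rw [← smul_sub, ← smul_sub, e1, smul_zero]

/-- `d(Γ(F₀))`: the exact `F₀`-valued `1`-forms, `X ↦ \bar 𝔏_X ν` with `ν ∈ Γ(F₀)`. -/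
def exactForms (h𝒜 : 𝒜.Transitive) : Submodule ℝ (BundleMap E E (TB E M) FF F) where
  carrier := {θ | ∃ ν ∈ R.secF₀, ∀ (x : M) (X : TB E M x), θ x X = R.reduced h𝒜 X ν}
  zero_mem' := ⟨0, R.secF₀.zero_mem, fun x X ↦ (map_zero (R.reduced h𝒜 X)).symm⟩
  add_mem' := by
    rintro θ θ' ⟨ν, hν, h⟩ ⟨ν', hν', h'⟩
    exact ⟨ν + ν', R.secF₀.add_mem hν hν', fun x X ↦ by rw [map_add, ← h, ← h']; rfl⟩
  smul_mem' := by
    rintro c θ ⟨ν, hν, h⟩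
    exact ⟨c • ν, R.secF₀.smul_mem c hν, fun x X ↦ by rw [map_smul, ← h]; rfl⟩

/-- `H¹_{deR}(M, F₀) = D¹(TM, F₀) / d(Γ(F₀))`. -/
abbrev H1deR (h𝒜 : 𝒜.Transitive) :=
  R.closedForms h𝒜 ⧸ (R.exactForms h𝒜).submoduleOf (R.closedForms h𝒜)

end Cohomology

end LieAlgebroid.Representation

end Algebroids

end LieAlgd

end

/-! Since `ρ` is fibrewise surjective, `θ` is recovered from `θ ∘ ρ`, and a bundle map `Ω` killing
`L = ker ρ` descends to each fibre of `TM`. The descended map is smooth because `ρ` has smooth local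
right inverses (`BundleMap.exists_local_rightInverse`, `BundleMap.exists_pullback_eq`).

On sections with values in `F₀` the operator `𝔏_u` depends only on `ρ(u)`, and `ρ` preserves
brackets, so the cocycle identity for `θ ∘ ρ` on `a, b` is closedness of `θ` on `ρ(a), ρ(b)`.
Closedness at a point involves only germs of vector fields, so lifting cut-off fields to `A`
suffices for the converse.

For cohomology, `ρ^* θ = 𝔏 μ` forces `𝔏_u μ = θ(ρ u) = 0` for `u ∈ L`, so the primitive `μ` already
lies in `Γ(F₀)`. Thus `ρ^* θ` is a coboundary exactly when `θ` is exact
(`pullback_mem_coboundaries_iff`): one direction makes the induced map well defined, the other makes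
it injective. -/

namespace LieAlgd

/-! ### Lifting and factoring through a fibrewise surjective bundle map -/

section Bundles

variable {E : Type*} [NormedAddCommGroup E] [NormedSpace ℝ E]
  {M : Type*} [TopologicalSpace M] [ChartedSpace E M]
  {FU : Type*} [NormedAddCommGroup FU] [NormedSpace ℝ FU]
  {U : M → Type*} [∀ x, AddCommGroup (U x)] [∀ x, Module ℝ (U x)] [∀ x, TopologicalSpace (U x)]
  [TopologicalSpace (TotalSpace FU U)] [FiberBundle FU U] [VectorBundle ℝ FU U]
  {FV : Type*} [NormedAddCommGroup FV] [NormedSpace ℝ FV]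
  {V : M → Type*} [∀ x, AddCommGroup (V x)] [∀ x, Module ℝ (V x)] [∀ x, TopologicalSpace (V x)]
  [TopologicalSpace (TotalSpace FV V)] [FiberBundle FV V] [VectorBundle ℝ FV V]
  [∀ x, IsTopologicalAddGroup (V x)] [∀ x, ContinuousSMul ℝ (V x)]
  {FW : Type*} [NormedAddCommGroup FW] [NormedSpace ℝ FW]
  {W : M → Type*} [∀ x, AddCommGroup (W x)] [∀ x, Module ℝ (W x)] [∀ x, TopologicalSpace (W x)]
  [TopologicalSpace (TotalSpace FW W)] [FiberBundle FW W] [VectorBundle ℝ FW W]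
  [∀ x, IsTopologicalAddGroup (W x)] [∀ x, ContinuousSMul ℝ (W x)]

theorem BundleMap.pullback_injective
    (ρ : BundleMap E FU U FV V) (hρ : ∀ x, Function.Surjective (ρ x)) :
    Function.Injective (BundleMap.pullback (FW := FW) (W := W) ρ) := by
  intro θ θ' h
  ext x v
  obtain ⟨u, rfl⟩ := hρ x v
  exact DFunLike.congr_fun (DFunLike.congr_fun h x) u

variable [FiniteDimensional ℝ FV]
  [ContMDiffVectorBundle ∞ FU U 𝓘(ℝ, E)] [ContMDiffVectorBundle ∞ FV V 𝓘(ℝ, E)]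

/-- A fibrewise surjective smooth bundle map has smooth local right inverses, here expressed in
the preferred trivializations at `x₀`. -/
theorem BundleMap.exists_local_rightInverse
    (ρ : BundleMap E FU U FV V) (hρ : ∀ x, Function.Surjective (ρ x)) (x₀ : M) :
    ∃ (S : Set M) (G : M → FV →L[ℝ] FU), IsOpen S ∧ x₀ ∈ S ∧
      S ⊆ (trivializationAt FU U x₀).baseSet ∧ S ⊆ (trivializationAt FV V x₀).baseSet ∧
      ContMDiffOn 𝓘(ℝ, E) 𝓘(ℝ, FV →L[ℝ] FU) ∞ G S ∧
      ∀ y ∈ S, ∀ v, ρ y ((trivializationAt FU U x₀).symmL ℝ y (G y v)) =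
        (trivializationAt FV V x₀).symmL ℝ y v := by
  have : CompleteSpace FV := FiniteDimensional.complete ℝ FV
  set tU := trivializationAt FU U x₀
  set tV := trivializationAt FV V x₀
  have hU₀ : x₀ ∈ tU.baseSet := FiberBundle.mem_baseSet_trivializationAt' x₀
  have hV₀ : x₀ ∈ tV.baseSet := FiberBundle.mem_baseSet_trivializationAt' x₀
  -- `N` is `ρ` read in the two trivializations. It agrees by definition with the local expression
  -- of `ρ` as a section of `Hom(U, V)`, whence its smoothness.
  let N : M → FU →L[ℝ] FV := fun y ↦
    (tV.continuousLinearMapAt ℝ y).comp ((ρ y).comp (tU.symmL ℝ y))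
  have hN : ContMDiffOn 𝓘(ℝ, E) 𝓘(ℝ, FU →L[ℝ] FV) ∞ N (tU.baseSet ∩ tV.baseSet) := by
    have h := ((trivializationAt (FU →L[ℝ] FV) (fun x : M ↦ U x →L[ℝ] V x)
      x₀).contMDiffOn_section_baseSet_iff (IB := 𝓘(ℝ, E)) (n := ∞)).1 ρ.contMDiff.contMDiffOn
    simp only [hom_trivializationAt_apply, hom_trivializationAt_baseSet] at h
    exact h
  have hN₀ : Function.Surjective (N x₀) := by
    intro v
    obtain ⟨u, hu⟩ := hρ x₀ (tV.symmL ℝ x₀ v)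
    refine ⟨tU.continuousLinearMapAt ℝ x₀ u, ?_⟩
    simp only [N, ContinuousLinearMap.comp_apply]
    rw [tU.symmL_continuousLinearMapAt hU₀, hu, tV.continuousLinearMapAt_symmL hV₀]
  -- A right inverse `s` at the single point `x₀` is enough: `N y ∘ s` is the identity at `x₀`,
  -- hence invertible nearby, and `s ∘ (N y ∘ s)⁻¹` is then a right inverse of `N y` that varies
  -- smoothly with `y`.
  obtain ⟨s, hs⟩ := (N x₀ : FU →ₗ[ℝ] FV).exists_rightInverse_of_surjective
    (LinearMap.range_eq_top.2 hN₀)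
  let s' : FV →L[ℝ] FU := LinearMap.toContinuousLinearMap s
  let K : M → FV →L[ℝ] FV := fun y ↦ (N y).comp s'
  have hK : ContMDiffOn 𝓘(ℝ, E) 𝓘(ℝ, FV →L[ℝ] FV) ∞ K (tU.baseSet ∩ tV.baseSet) :=
    hN.clm_comp contMDiffOn_const
  have hK₀ : K x₀ = ContinuousLinearMap.id ℝ FV := by
    ext v
    exact LinearMap.congr_fun hs v
  let Inv : Set (FV →L[ℝ] FV) := range ((↑) : (FV ≃L[ℝ] FV) → FV →L[ℝ] FV)
  have hInv : IsOpen Inv := ContinuousLinearEquiv.isOpen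
  have hopen : IsOpen (tU.baseSet ∩ tV.baseSet) := tU.open_baseSet.inter tV.open_baseSet
  refine ⟨(tU.baseSet ∩ tV.baseSet) ∩ K ⁻¹' Inv,
    fun y ↦ s'.comp (ContinuousLinearMap.inverse (K y)),
    hK.continuousOn.isOpen_inter_preimage hopen hInv,
    ⟨⟨hU₀, hV₀⟩, ?_⟩, fun y hy ↦ hy.1.1, fun y hy ↦ hy.1.2, ?_, ?_⟩
  · exact ⟨ContinuousLinearEquiv.refl ℝ FV, hK₀.symm⟩
  · refine contMDiffOn_const.clm_comp ?_
    intro y hy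
    obtain ⟨e, he⟩ := hy.2
    have h1 : ContDiffAt ℝ ∞ ContinuousLinearMap.inverse (K y) := by
      rw [← he]
      exact contDiffAt_map_inverse e
    exact h1.contMDiffAt.comp_contMDiffWithinAt y ((hK y hy.1).mono inter_subset_left)
  · rintro y ⟨⟨hyU, hyV⟩, e, he⟩ v
    have h1 : N y (s' (ContinuousLinearMap.inverse (K y) v)) = v := by
      change K y (ContinuousLinearMap.inverse (K y) v) = v
      rw [← he, ContinuousLinearMap.inverse_equiv]
      exact e.apply_symm_apply v
    exact (tV.symmL_continuousLinearMapAt (R := ℝ) hyV (ρ y _)).symm.trans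
      (congrArg (tV.symmL ℝ y) h1)

/-- Local lifts of sections through a fibrewise surjective smooth bundle map. -/
theorem BundleMap.exists_smul_lift [FiniteDimensional ℝ E] [T2Space M]
    [IsManifold 𝓘(ℝ, E) ∞ M] (ρ : BundleMap E FU U FV V) (hρ : ∀ x, Function.Surjective (ρ x)) (x₀ : M) :
    ∃ χ : C^∞⟮𝓘(ℝ, E), M; 𝓘(ℝ, ℝ), ℝ⟯, (∀ᶠ y in 𝓝 x₀, χ y = 1) ∧
      ∀ X : Sec E FV V, ∃ a : Sec E FU U, ρ.app a = fsmul χ X := by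
  obtain ⟨S, G, hS, hx₀, hSU, hSV, hG, hρG⟩ := ρ.exists_local_rightInverse hρ x₀
  obtain ⟨χ, -, hχ⟩ := (SmoothBumpFunction.nhds_basis_tsupport (I := 𝓘(ℝ, E)) x₀).mem_iff.1
    (hS.mem_nhds hx₀)
  -- The cutoff depends only on the domain `S` of the right inverse, so one `χ` serves all sections
  -- `X`.
  refine ⟨⟨χ, χ.contMDiff⟩, χ.eventuallyEq_one, fun X ↦ ?_⟩
  set tU := trivializationAt FU U x₀
  set tV := trivializationAt FV V x₀
  let b : ∀ y, U y := fun y ↦ tU.symmL ℝ y (G y (tV.continuousLinearMapAt ℝ y (X y)))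
  have hX : ContMDiffOn 𝓘(ℝ, E) 𝓘(ℝ, FV) ∞ (fun y ↦ tV.continuousLinearMapAt ℝ y (X y)) S := by
    refine ((tV.contMDiffOn_section_iff hS hSV).1 X.contMDiff.contMDiffOn).congr
      fun y hy ↦ ?_
    simp [tV.coe_linearMapAt_of_mem (hSV hy)]
  have hb : ContMDiffOn 𝓘(ℝ, E) (𝓘(ℝ, E).prod 𝓘(ℝ, FU)) ∞
      (fun y ↦ TotalSpace.mk' FU y (b y)) S := by
    refine (tU.contMDiffOn_section_iff hS hSU).2 ((hG.clm_apply hX).congr fun y hy ↦ ?_)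
    have := tU.continuousLinearMapAt_symmL (R := ℝ) (hSU hy)
      (G y (tV.continuousLinearMapAt ℝ y (X y)))
    rw [tU.continuousLinearMapAt_apply ℝ, tU.coe_linearMapAt_of_mem (hSU hy)] at this
    exact this
  refine ⟨⟨fun y ↦ χ y • b y,
    ContMDiffOn.smul_section_of_tsupport χ.contMDiff.contMDiffOn hS hχ hb⟩, ?_⟩
  ext y
  change ρ y (χ y • b y) = χ y • X y
  rw [map_smul]
  by_cases hy : y ∈ S
  · simp only [b]
    rw [hρG y hy, tV.symmL_continuousLinearMapAt (hSV hy)]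
  · have hχ0 : χ y = 0 := image_eq_zero_of_notMem_tsupport fun h' ↦ hy (hχ h')
    simp [hχ0]

/-- A smooth bundle map that vanishes on the kernel of a fibrewise surjective smooth bundle map
`ρ` factors through `ρ`. -/
theorem BundleMap.exists_pullback_eq
    (ρ : BundleMap E FU U FV V) (hρ : ∀ x, Function.Surjective (ρ x)) (Ω : BundleMap E FU U FW W)
    (hΩ : ∀ x u, ρ x u = 0 → Ω x u = 0) :
    ∃ θ : BundleMap E FV V FW W, BundleMap.pullback ρ θ = Ω := by
  have hfac : ∀ x u u', ρ x u = ρ x u' → Ω x u = Ω x u' := fun x u u' h ↦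
    sub_eq_zero.1 (by rw [← map_sub]; exact hΩ x _ (by rw [map_sub, h, sub_self]))
  -- Composing `Ω x` with the local right inverse, instead of an arbitrary linear one, makes the
  -- descended map continuous at once.
  have hpt : ∀ x, ∃ T : V x →L[ℝ] W x, ∀ u, T (ρ x u) = Ω x u := by
    intro x
    obtain ⟨S, G, -, hx, -, hSV, -, hρG⟩ := ρ.exists_local_rightInverse hρ x
    refine ⟨((Ω x).comp ((trivializationAt FU U x).symmL ℝ x)).comp
      ((G x).comp ((trivializationAt FV V x).continuousLinearMapAt ℝ x)), fun u ↦ ?_⟩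
    refine hfac x _ _ ?_
    change ρ x ((trivializationAt FU U x).symmL ℝ x (G x _)) = ρ x u
    exact (hρG x hx _).trans (Trivialization.symmL_continuousLinearMapAt _ (hSV hx) _)
  choose T hT using hpt
  refine ⟨⟨T, fun x₀ ↦ (contMDiffAt_hom_bundle _).2 ⟨contMDiffAt_id, ?_⟩⟩, ?_⟩
  · obtain ⟨S, G, hS, hx₀, -, -, hG, hρG⟩ := ρ.exists_local_rightInverse hρ x₀
    have h1 := ((contMDiffAt_hom_bundle _).1 (Ω.contMDiff x₀)).2
    -- Near `x₀`, the coordinate expression of `T` is that of `Ω` composed with `G`.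
    refine (h1.clm_comp (hG.contMDiffAt (hS.mem_nhds hx₀))).congr_of_eventuallyEq ?_
    filter_upwards [hS.mem_nhds hx₀] with y hy
    ext v
    simp only [ContinuousLinearMap.inCoordinates, ContinuousLinearMap.comp_apply]
    rw [← hρG y hy, hT]
  · ext x u
    exact hT x u

end Bundles

/-! ### Closed and exact forms under `ρ^*` -/

namespace LieAlgebroid.Representation

variable {E : Type*} [NormedAddCommGroup E] [NormedSpace ℝ E]
  {M : Type*} [TopologicalSpace M] [ChartedSpace E M] [IsManifold 𝓘(ℝ, E) ∞ M]
  {FA : Type*} [NormedAddCommGroup FA] [NormedSpace ℝ FA]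
  {A : M → Type*} [∀ x, AddCommGroup (A x)] [∀ x, Module ℝ (A x)] [∀ x, TopologicalSpace (A x)]
  [TopologicalSpace (TotalSpace FA A)] [FiberBundle FA A] [VectorBundle ℝ FA A]
  {FF : Type*} [NormedAddCommGroup FF] [NormedSpace ℝ FF]
  {F : M → Type*} [∀ x, AddCommGroup (F x)] [∀ x, Module ℝ (F x)] [∀ x, TopologicalSpace (F x)]
  [TopologicalSpace (TotalSpace FF F)] [FiberBundle FF F] [VectorBundle ℝ FF F]
  {𝒜 : LieAlgebroid E FA A} (R : 𝒜.Representation FF F)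

/-- The derivative of `χ` vanishes at `x`, so the symbol term of the Leibniz rule drops out. This
permits cutting off sections without changing `𝔏_u` at the point. -/
theorem op_fsmul_of_eventually_eq_one {x : M} (u : A x) (χ : C^∞⟮𝓘(ℝ, E), M; 𝓘(ℝ, ℝ), ℝ⟯)
    (hχ : ∀ᶠ y in 𝓝 x, χ y = 1) (μ : Sec E FF F) : R.op u (fsmul χ μ) = R.op u μ := by
  have h : mvfderiv 𝓘(ℝ, E) χ x = 0 := by
    have h1 : (χ : M → ℝ) =ᶠ[𝓝 x] fun _ ↦ 1 := hχ
    have h2 := h1.mfderiv_eq (I := 𝓘(ℝ, E)) (I' := 𝓘(ℝ, ℝ))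
    rw [← mvfderiv_const (I := 𝓘(ℝ, E)) (1 : ℝ) (x := x)]
    ext v
    exact DFunLike.congr_fun h2 v
  rw [op_fsmul, h, hχ.self_of_nhds]
  simp

variable [FiniteDimensional ℝ E] [T2Space M] [FiniteDimensional ℝ FF]
  [ContMDiffVectorBundle ∞ FF F 𝓘(ℝ, E)]

theorem reduced_anchor (h𝒜 : 𝒜.Transitive) {x : M} (u : A x) {ν : Sec E FF F}
    (hν : ν ∈ R.secF₀) : R.reduced h𝒜 (𝒜.anchor x u) ν = R.op u ν :=
  R.op_eq_of_anchor_eq (Function.surjInv_eq (h𝒜 x) _) hν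

variable [∀ x, IsTopologicalAddGroup (F x)] [∀ x, ContinuousSMul ℝ (F x)]

theorem pullback_mem_cocyclesF₀Zero (h𝒜 : 𝒜.Transitive) {θ : BundleMap E E (TB E M) FF F}
    (hθ : θ ∈ R.closedForms h𝒜) : BundleMap.pullback 𝒜.anchor θ ∈ R.cocyclesF₀Zero := by
  refine ⟨fun a b x ↦ ?_, fun x u ↦ hθ.1 x _, fun x v hv ↦ ?_⟩
  · have hF₀ : ∀ X : VF E M, θ.app X ∈ R.secF₀ := fun X y ↦ hθ.1 y (X y)
    have h := hθ.2 (𝒜.anchor.app a) (𝒜.anchor.app b) x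
    change R.reduced h𝒜 (𝒜.anchor x (a x)) _ - R.reduced h𝒜 (𝒜.anchor x (b x)) _ - _ = 0 at h
    -- The chosen preimages of `ρ(a x)` and `ρ(b x)` may be replaced by `a x` and `b x`, because `θ`
    -- takes values in `F₀`.
    rw [reduced_anchor R h𝒜 _ (hF₀ _), reduced_anchor R h𝒜 _ (hF₀ _), sub_eq_zero] at h
    change θ x (𝒜.anchor x (𝒜.bracket a b x)) = _
    rw [𝒜.anchor_bracket]
    exact h.symm
  · have hv0 : 𝒜.anchor x v = 0 := hv
    change θ x (𝒜.anchor x v) = 0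
    rw [hv0, map_zero]

theorem mem_closedForms_of_pullback_mem [ContMDiffVectorBundle ∞ FA A 𝓘(ℝ, E)]
    (h𝒜 : 𝒜.Transitive) {θ : BundleMap E E (TB E M) FF F}
    (hθ : BundleMap.pullback 𝒜.anchor θ ∈ R.cocyclesF₀Zero) : θ ∈ R.closedForms h𝒜 := by
  have hF₀ : ∀ (x : M) (X : TB E M x), θ x X ∈ R.F₀ x := by
    intro x X
    obtain ⟨u, rfl⟩ := h𝒜 x X
    exact hθ.2.1 x u
  refine ⟨hF₀, fun X Y x ↦ ?_⟩
  have hsec : ∀ X : VF E M, θ.app X ∈ R.secF₀ := fun X y ↦ hF₀ y (X y)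
  -- `X` and `Y` are replaced by `χX` and `χY`, which lift to `a` and `b`. As `χ = 1` near `x`,
  -- neither the operators nor the bracket at `x` notice the change.
  obtain ⟨χ, hχ, hlift⟩ := 𝒜.anchor.exists_smul_lift h𝒜 x
  obtain ⟨a, ha⟩ := hlift X
  obtain ⟨b, hb⟩ := hlift Y
  have happ : ∀ (c : Sec E FA A) (Z : VF E M), 𝒜.anchor.app c = fsmul χ Z →
      (BundleMap.pullback 𝒜.anchor θ).app c = fsmul χ (θ.app Z) := by
    intro c Z h
    ext y
    change θ y (𝒜.anchor.app c y) = χ y • θ y (Z y)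
    rw [h]
    exact map_smul (θ y) _ _
  have hnear : ∀ (c : Sec E FA A) (Z : VF E M), 𝒜.anchor.app c = fsmul χ Z →
      (fun y ↦ 𝒜.anchor y (c y)) =ᶠ[𝓝 x] Z := by
    intro c Z h
    filter_upwards [hχ] with y hy
    change 𝒜.anchor.app c y = Z y
    rw [h]
    change χ y • Z y = Z y
    rw [hy, one_smul]
  have key := hθ.1 a b x
  rw [happ a X ha, happ b Y hb, op_fsmul_of_eventually_eq_one R _ χ hχ,
    op_fsmul_of_eventually_eq_one R _ χ hχ, ← reduced_anchor R h𝒜 _ (hsec _),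
    ← reduced_anchor R h𝒜 _ (hsec _)] at key
  change θ x (𝒜.anchor x (𝒜.bracket a b x)) = _ at key
  have hax : 𝒜.anchor x (a x) = X x := (hnear a X ha).self_of_nhds
  have hbx : 𝒜.anchor x (b x) = Y x := (hnear b Y hb).self_of_nhds
  rw [𝒜.anchor_bracket, (hnear a X ha).mlieBracket_vectorField_eq (hnear b Y hb),
    hax, hbx] at key
  rw [← key, sub_self]

theorem bijOn_pullback_anchor [ContMDiffVectorBundle ∞ FA A 𝓘(ℝ, E)] (h𝒜 : 𝒜.Transitive) :
    Set.BijOn (fun θ ↦ BundleMap.pullback (FW := FF) (W := F) 𝒜.anchor θ)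
      (R.closedForms h𝒜) R.cocyclesF₀Zero := by
  refine ⟨fun θ hθ ↦ R.pullback_mem_cocyclesF₀Zero h𝒜 hθ,
    (BundleMap.pullback_injective 𝒜.anchor h𝒜).injOn, fun Ω hΩ ↦ ?_⟩
  -- Vanishing on `L` is by definition vanishing on the kernel of the anchor.
  obtain ⟨θ, rfl⟩ := BundleMap.exists_pullback_eq 𝒜.anchor h𝒜 Ω hΩ.2.2
  exact ⟨θ, R.mem_closedForms_of_pullback_mem h𝒜 hΩ, rfl⟩

/-- A form `θ` is exact if and only if `ρ^* θ` is a coboundary. -/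
theorem pullback_mem_coboundaries_iff (h𝒜 : 𝒜.Transitive) {θ : BundleMap E E (TB E M) FF F} :
    BundleMap.pullback 𝒜.anchor θ ∈ R.coboundaries ↔ θ ∈ R.exactForms h𝒜 := by
  constructor
  · rintro ⟨μ, hμ⟩
    -- `μ` itself is the extension of `μ x` that witnesses membership in `F₀`.
    refine ⟨μ, fun x u hu ↦ ⟨μ, rfl, ?_⟩, fun x X ↦ ?_⟩
    · have hu0 : 𝒜.anchor x u = 0 := hu
      rw [← hμ x u]
      change θ x (𝒜.anchor x u) = 0
      rw [hu0, map_zero]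
    · have h := hμ x (Function.surjInv (h𝒜 x) X)
      change θ x (𝒜.anchor x (Function.surjInv (h𝒜 x) X)) = _ at h
      rwa [Function.surjInv_eq (h𝒜 x)] at h
  · rintro ⟨ν, hν, h⟩
    exact ⟨ν, fun x u ↦ (h x _).trans (R.reduced_anchor h𝒜 u hν)⟩

/-- The map `D¹(TM, F₀) → D¹(A, F)`, `θ ↦ ρ^* θ`. -/
noncomputable def pullbackClosedForms (h𝒜 : 𝒜.Transitive) : R.closedForms h𝒜 →ₗ[ℝ] R.cocycles :=
  (BundleMap.pullback 𝒜.anchor).restrict fun _ hθ ↦ (R.pullback_mem_cocyclesF₀Zero h𝒜 hθ).1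

/-- The inclusion `≥` lets `ρ^*` pass to the quotients; the inclusion `≤` makes the induced map
injective. -/
theorem comap_pullbackClosedForms (h𝒜 : 𝒜.Transitive) :
    (R.coboundaries.submoduleOf R.cocycles).comap (R.pullbackClosedForms h𝒜) =
      (R.exactForms h𝒜).submoduleOf (R.closedForms h𝒜) := by
  ext θ
  exact R.pullback_mem_coboundaries_iff h𝒜

end LieAlgebroid.Representation

end LieAlgd

theorem mainTheorem6
    {E : Type*} [NormedAddCommGroup E] [NormedSpace ℝ E] [FiniteDimensional ℝ E]
    {M : Type*} [TopologicalSpace M] [ChartedSpace E M] [IsManifold 𝓘(ℝ, E) ∞ M]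
    [T2Space M] [SecondCountableTopology M] [ConnectedSpace M]
    {FA : Type*} [NormedAddCommGroup FA] [NormedSpace ℝ FA] [FiniteDimensional ℝ FA]
    {A : M → Type*} [∀ x, AddCommGroup (A x)] [∀ x, Module ℝ (A x)]
    [∀ x, TopologicalSpace (A x)] [TopologicalSpace (TotalSpace FA A)]
    [FiberBundle FA A] [VectorBundle ℝ FA A] [ContMDiffVectorBundle ∞ FA A 𝓘(ℝ, E)]
    {FF : Type*} [NormedAddCommGroup FF] [NormedSpace ℝ FF] [FiniteDimensional ℝ FF]
    {F : M → Type*} [∀ x, AddCommGroup (F x)] [∀ x, Module ℝ (F x)]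
    [∀ x, TopologicalSpace (F x)] [TopologicalSpace (TotalSpace FF F)]
    [FiberBundle FF F] [VectorBundle ℝ FF F] [ContMDiffVectorBundle ∞ FF F 𝓘(ℝ, E)]
    [∀ x, IsTopologicalAddGroup (F x)] [∀ x, ContinuousSMul ℝ (F x)]
    (𝒜 : LieAlgd.LieAlgebroid E FA A) (h𝒜 : 𝒜.Transitive) (R : 𝒜.Representation FF F) :
    Set.BijOn (fun θ ↦ LieAlgd.BundleMap.pullback (FW := FF) (W := F) 𝒜.anchor θ)
      (R.closedForms h𝒜) R.cocyclesF₀Zero ∧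
    ∃ Φ : R.H1deR h𝒜 →ₗ[ℝ] R.H1, Function.Injective Φ ∧
      ∀ θ : R.closedForms h𝒜, ∃ hθ : LieAlgd.BundleMap.pullback 𝒜.anchor θ.1 ∈ R.cocycles,
        Φ (Submodule.Quotient.mk θ) =
          Submodule.Quotient.mk ⟨LieAlgd.BundleMap.pullback 𝒜.anchor θ.1, hθ⟩ := by
  refine ⟨R.bijOn_pullback_anchor h𝒜,
    Submodule.mapQ _ _ (R.pullbackClosedForms h𝒜) (R.comap_pullbackClosedForms h𝒜).ge, ?_,
    fun θ ↦ ⟨(R.pullback_mem_cocyclesF₀Zero h𝒜 θ.2).1, rfl⟩⟩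
  -- A map lifted from a quotient is injective once the kernel before lifting lies in the subspace
  -- divided out; here that kernel consists of the closed forms whose pullback is a coboundary.
  rw [← LinearMap.ker_eq_bot, Submodule.mapQ, Submodule.ker_liftQ_eq_bot]
  rw [LinearMap.ker_comp, Submodule.ker_mkQ]
  exact (R.comap_pullbackClosedForms h𝒜).le
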